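/- Let $M>0$ and let $\mathbb T_M=\mathbb R/M\mathbb Z$. Let $\mathcal S(\mathbb T_M)$ be the space of real smooth $M$-periodic functions with its Fréchet topology (uniform convergence of all derivatives), and $\mathcal S'(\mathbb T_M)$ its topological dual, the space of periodic distributions; functions are viewed as distributions through $\langle f,\varphi\rangle=\int_0^M f(t)\varphi(t)\,dt$. Let $\mathrm L=\mathrm D^{\alpha+1}$ with an integer $\alpha\ge 1$, and let $\mathrm L^\dagger$ be its pseudoinverse on $\mathcal S'(\mathbb T_M)$, which multiplies the $k$-th Fourier coefficient by $(2\pi i k/M)^{-(\alpha+1)}$ for $k\neq0$ and sets the $0$-th one to zero. For $w\in\mathcal S'(\mathbb T_M)$ and $\mathbf w=(w_1,w_2)\in\mathcal S'(\mathbb T_M)^2$ put $$\|w\|_{\rm TV}=\sup_{\|\varphi\|_\infty=1}\langle w,\varphi\rangle,\qquad \mathcal R(\mathbf w)=\sup_{\sup_t\|(\varphi_1(t),\varphi_2(t))\|_2=1}\big(\langle w_1,\varphi_1\rangle+\langle w_2,\varphi_2\rangle\big)\in[0,\infty],$$ with $\varphi,\varphi_1,\varphi_2\in\mathcal S(\mathbb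 T_M)$. Let $\mathcal M(\mathbb T_M)\subset\mathcal S'(\mathbb T_M)$ be the space of finite signed Radon measures on $\mathbb T_M$, $\mathcal M_0(\mathbb T_M)=\{w\in\mathcal M(\mathbb T_M):\langle w,1\rangle=0\}$ with the norm $\|\cdot\|_{\rm TV}$, and let $$\mathcal M_{\rm L}(\mathbb T_M)=\{f\in\mathcal S'(\mathbb T_M):\|\mathrm L f\|_{\rm TV}<\infty\},\qquad \mathcal X_{\rm L}(\mathbb T_M)=\{\mathbf r=(r_1,r_2)\in\mathcal S'(\mathbb T_M)^2:\mathcal R(\mathrm L r_1,\mathrm L r_2)<\infty\},$$ with the norms $\|f\|=\|\mathrm Lf\|_{\rm TV}+|\langle f,1\rangle|$ and $\|\mathbf r\|=\mathcal R(\mathrm L r_1,\mathrm L r_2)+\max_i|\langle r_i,1\rangle|$. Then $\mathcal X_{\rm L}(\mathbb T_M)=\mathcal M_{\rm L}(\mathbb T_M)\times\mathcal M_{\rm L}(\mathbb T_M)$, as subspaces of $\mathcal S'(\mathbb T_M)^2$ and with the same topology. Moreover, the mapping $$T_{\rm L}:\mathcal X_{\rm L}(\mathbb T_M)\to\mathcal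 M_0(\mathbb T_M)^2\times\mathbb R^2,\qquad T_{\rm L}(\mathbf r)=\big(\mathrm L r_1,\mathrm L r_2,\langle r_1,1\rangle,\langle r_2,1\rangle\big)$$ is well defined and is an isomorphism (a linear homeomorphism), whose inverse is $$T_{\rm L}^{-1}(\mathbf w,\mathbf a)=\Big(\mathrm L^\dagger w_1+\tfrac{a_1}{M},\ \mathrm L^\dagger w_2+\tfrac{a_2}{M}\Big).$$ -/

import Mathlib

open scoped ContDiff
open MeasureTheory

noncomputable section

namespace PeriodicCurve

/-! ### Periodic test functions -/

/-- The space `S(T_M)` of smooth `M`-periodic functions `ℝ → ℝ`. -/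
structure TestFun (M : ℝ) where
  toFun : ℝ → ℝ
  contDiff' : ContDiff ℝ ∞ toFun
  periodic' : Function.Periodic toFun M

namespace TestFun

variable {M : ℝ}

instance : FunLike (TestFun M) ℝ ℝ where
  coe := toFun
  coe_injective φ ψ h := by
    cases φ
    cases ψ
    congr

theorem contDiff (φ : TestFun M) : ContDiff ℝ ∞ φ := φ.contDiff'

theorem periodic (φ : TestFun M) : Function.Periodic φ M := φ.periodic'

theorem continuous (φ : TestFun M) : Continuous φ := φ.contDiff.continuous

@[ext] theorem ext {φ ψ : TestFun M} (h : ∀ t, φ t = ψ t) : φ = ψ := DFunLike.ext _ _ h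

instance : Zero (TestFun M) := ⟨⟨fun _ => 0, contDiff_const, fun _ => rfl⟩⟩

instance : Add (TestFun M) :=
  ⟨fun φ ψ => ⟨fun t => φ t + ψ t, φ.contDiff.add ψ.contDiff, φ.periodic.add ψ.periodic⟩⟩

instance : Neg (TestFun M) := ⟨fun φ => ⟨fun t => -φ t, φ.contDiff.neg, fun t => by
  simp only [φ.periodic t]⟩⟩

instance : Sub (TestFun M) :=
  ⟨fun φ ψ => ⟨fun t => φ t - ψ t, φ.contDiff.sub ψ.contDiff, φ.periodic.sub ψ.periodic⟩⟩

instance {R : Type*} [SMul R ℝ] [IsScalarTower R ℝ ℝ] : SMul R (TestFun M) :=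
  ⟨fun c φ => ⟨fun t => c • φ t, by
    have h : (fun t => c • φ t) = fun t => (c • (1 : ℝ)) * φ t := by
      funext t
      rw [smul_mul_assoc, one_mul]
    rw [h]
    exact contDiff_const.mul φ.contDiff, fun t => by simp only [φ.periodic t]⟩⟩

instance : AddCommGroup (TestFun M) :=
  DFunLike.coe_injective.addCommGroup (fun φ : TestFun M => (φ : ℝ → ℝ)) rfl (fun _ _ => rfl)
    (fun _ => rfl) (fun _ _ => rfl) (fun _ _ => rfl) (fun _ _ => rfl)

/-- Evaluation on `ℝ`, as an additive map. -/
def coeHom (M : ℝ) : TestFun M →+ (ℝ → ℝ) where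
  toFun φ := φ
  map_zero' := rfl
  map_add' _ _ := rfl

instance : Module ℝ (TestFun M) :=
  DFunLike.coe_injective.module ℝ (coeHom M) (fun _ _ => rfl)

@[simp] theorem add_apply (φ ψ : TestFun M) (t : ℝ) : (φ + ψ) t = φ t + ψ t := rfl

@[simp] theorem sub_apply (φ ψ : TestFun M) (t : ℝ) : (φ - ψ) t = φ t - ψ t := rfl

@[simp] theorem neg_apply (φ : TestFun M) (t : ℝ) : (-φ) t = -φ t := rfl

@[simp] theorem smul_apply (c : ℝ) (φ : TestFun M) (t : ℝ) : (c • φ) t = c * φ t := rfl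

@[simp] theorem zero_apply (t : ℝ) : (0 : TestFun M) t = 0 := rfl

theorem intervalIntegrable (φ : TestFun M) (a b : ℝ) :
    IntervalIntegrable φ volume a b := φ.continuous.intervalIntegrable a b

/-- The constant test function `1`. -/
def one (M : ℝ) : TestFun M := ⟨fun _ => 1, contDiff_const, fun _ => rfl⟩

@[simp] theorem one_apply (t : ℝ) : one M t = 1 := rfl

/-- The derivative `φ ↦ φ'` on test functions. -/
def derivLin (M : ℝ) : TestFun M →ₗ[ℝ] TestFun M where
  toFun φ := ⟨fun t => deriv φ t, (contDiff_infty_iff_deriv.1 φ.contDiff).2, fun t => by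
    have h : (fun s => φ (s + M)) = φ := funext φ.periodic
    change deriv φ (t + M) = deriv φ t
    rw [← deriv_comp_add_const, h]⟩
  map_add' φ ψ := by
    ext t
    exact deriv_add ((contDiff_infty_iff_deriv.1 φ.contDiff).1 t)
      ((contDiff_infty_iff_deriv.1 ψ.contDiff).1 t)
  map_smul' c φ := by
    ext t
    exact deriv_const_mul c ((contDiff_infty_iff_deriv.1 φ.contDiff).1 t)

/-- The integral over one period, `φ ↦ ∫₀ᴹ φ(t) dt`. -/
def integralLin (M : ℝ) : TestFun M →ₗ[ℝ] ℝ where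
  toFun φ := ∫ t in (0 : ℝ)..M, φ t
  map_add' φ ψ := intervalIntegral.integral_add (φ.intervalIntegrable _ _)
    (ψ.intervalIntegrable _ _)
  map_smul' c _ := intervalIntegral.integral_const_mul c _

/-- The mean-free part `φ - M⁻¹ ∫₀ᴹ φ` of a test function. -/
def meanFree (M : ℝ) : TestFun M →ₗ[ℝ] TestFun M :=
  LinearMap.id - (M⁻¹ • integralLin M).smulRight (one M)

theorem meanFree_apply (φ : TestFun M) : meanFree M φ = φ - (M⁻¹ * integralLin M φ) • one M := rfl

theorem integralLin_one : integralLin M (one M) = M := by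
  change ∫ t in (0 : ℝ)..M, (1 : ℝ) = M
  simp

theorem derivLin_one : derivLin M (one M) = 0 := by
  ext t
  exact deriv_const t (1 : ℝ)

variable [hM : Fact (0 < M)]

theorem bddAbove (φ : TestFun M) : BddAbove (Set.range fun t => |φ t|) := by
  obtain ⟨C, hC⟩ := (φ.periodic.isBounded_of_continuous hM.out.ne' φ.continuous).exists_norm_le
  exact ⟨C, by rintro _ ⟨t, rfl⟩; exact hC _ ⟨t, rfl⟩⟩

/-- The uniform norm `sup_t |φ(t)|` on test functions, as a seminorm. -/
def supSeminorm (M : ℝ) [Fact (0 < M)] : Seminorm ℝ (TestFun M) :=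
  Seminorm.ofSMulLE (fun φ => ⨆ t, |φ t|) (by simp)
    (fun φ ψ => ciSup_le fun t => (abs_add_le _ _).trans
      (add_le_add (le_ciSup φ.bddAbove t) (le_ciSup ψ.bddAbove t)))
    (fun c φ => ciSup_le fun t => by
      rw [smul_apply, abs_mul, Real.norm_eq_abs]
      exact mul_le_mul_of_nonneg_left (le_ciSup φ.bddAbove t) (abs_nonneg c))

theorem supSeminorm_apply (φ : TestFun M) : supSeminorm M φ = ⨆ t, |φ t| := rfl

theorem abs_le_supSeminorm (φ : TestFun M) (t : ℝ) : |φ t| ≤ supSeminorm M φ :=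
  le_ciSup φ.bddAbove t

/-- The seminorms `φ ↦ sup_t |φ⁽ᵏ⁾(t)|`, `k = 0, 1, 2, …`. -/
def seminorms (M : ℝ) [Fact (0 < M)] : SeminormFamily ℝ (TestFun M) ℕ :=
  fun k => (supSeminorm M).comp (derivLin M ^ k)

/-- The usual Fréchet topology of `S(T_M)`: uniform convergence of all derivatives. -/
instance : TopologicalSpace (TestFun M) := (seminorms M).moduleFilterBasis.topology

theorem withSeminorms (M : ℝ) [Fact (0 < M)] : WithSeminorms (seminorms M) := ⟨rfl⟩

instance : IsTopologicalAddGroup (TestFun M) := (withSeminorms M).topologicalAddGroup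

instance : ContinuousSMul ℝ (TestFun M) := (withSeminorms M).continuousSMul

theorem seminorms_zero (φ : TestFun M) : seminorms M 0 φ = supSeminorm M φ := rfl

theorem seminorms_succ (k : ℕ) (φ : TestFun M) :
    seminorms M (k + 1) φ = seminorms M k (derivLin M φ) := by
  simp only [seminorms, Seminorm.comp_apply, pow_succ]
  rfl

theorem abs_integralLin_le (φ : TestFun M) : |integralLin M φ| ≤ M * supSeminorm M φ := by
  have := intervalIntegral.norm_integral_le_of_norm_le_const (a := 0) (b := M)
    (f := φ) (C := supSeminorm M φ) (fun t _ => φ.abs_le_supSeminorm t)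
  rwa [sub_zero, abs_of_pos hM.out, mul_comm, Real.norm_eq_abs] at this

/-- `φ ↦ φ'` as a continuous linear map of `S(T_M)`. -/
def derivCLM (M : ℝ) [Fact (0 < M)] : TestFun M →L[ℝ] TestFun M where
  toLinearMap := derivLin M
  cont := WithSeminorms.continuous_of_isBounded (withSeminorms M) (withSeminorms M) _
    (Seminorm.IsBounded.of_real fun k => ⟨{k + 1}, 1, fun φ => by
      simp [seminorms_succ]⟩)

/-- `φ ↦ ∫₀ᴹ φ(t) dt` as a continuous linear functional on `S(T_M)`. -/
def integralCLM (M : ℝ) [Fact (0 < M)] : TestFun M →L[ℝ] ℝ where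
  toLinearMap := integralLin M
  cont := WithSeminorms.continuous_of_isBounded (withSeminorms M) (norm_withSeminorms ℝ ℝ) _
    (Seminorm.IsBounded.of_real fun _ => ⟨{0}, M, fun φ => by
      simpa [Seminorm.comp_apply, seminorms_zero] using abs_integralLin_le φ⟩)

theorem integralLin_meanFree (φ : TestFun M) : integralLin M (meanFree M φ) = 0 := by
  have h : M ≠ 0 := hM.out.ne'
  rw [meanFree_apply, map_sub, map_smul, integralLin_one, smul_eq_mul]
  field_simp
  ring

/-- The periodic primitive `t ↦ ∫₀ᵗ (φ - M⁻¹ ∫₀ᴹ φ)`, before normalization of its mean. -/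
def primitiveAux (M : ℝ) [hM : Fact (0 < M)] : TestFun M →ₗ[ℝ] TestFun M where
  toFun φ := ⟨fun t => ∫ s in (0 : ℝ)..t, meanFree M φ s,
    contDiff_infty_iff_deriv.2 ⟨fun t =>
        ((meanFree M φ).continuous.integral_hasStrictDerivAt 0 t).hasDerivAt.differentiableAt, by
      have : deriv (fun t => ∫ s in (0 : ℝ)..t, meanFree M φ s) = meanFree M φ :=
        funext fun t => (meanFree M φ).continuous.deriv_integral _ 0 t
      rw [this]
      exact (meanFree M φ).contDiff⟩, fun t => by
    have h1 := (meanFree M φ).periodic.intervalIntegral_add_eq t 0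
    have h2 : ∫ s in (0 : ℝ)..M, meanFree M φ s = 0 := integralLin_meanFree φ
    rw [zero_add, h2] at h1
    have h3 := intervalIntegral.integral_add_adjacent_intervals
      ((meanFree M φ).intervalIntegrable 0 t) ((meanFree M φ).intervalIntegrable t (t + M))
    change ∫ s in (0 : ℝ)..(t + M), meanFree M φ s = ∫ s in (0 : ℝ)..t, meanFree M φ s
    rw [← h3, h1, add_zero]⟩
  map_add' φ ψ := by
    ext t
    change ∫ s in (0 : ℝ)..t, meanFree M (φ + ψ) s = _
    rw [map_add]
    exact intervalIntegral.integral_add ((meanFree M φ).intervalIntegrable _ _)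
      ((meanFree M ψ).intervalIntegrable _ _)
  map_smul' c φ := by
    ext t
    change ∫ s in (0 : ℝ)..t, meanFree M (c • φ) s = _
    rw [map_smul]
    exact intervalIntegral.integral_const_mul c _

/-- The pseudoinverse of `φ ↦ φ'` on test functions: `φ` is mapped to the unique mean-free
periodic primitive of `φ - M⁻¹ ∫₀ᴹ φ`. In terms of Fourier coefficients, it multiplies the `k`-th
coefficient by `(2πik/M)⁻¹` for `k ≠ 0` and annihilates the `0`-th one. -/
def primitiveLin (M : ℝ) [Fact (0 < M)] : TestFun M →ₗ[ℝ] TestFun M :=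
  meanFree M ∘ₗ primitiveAux M

theorem derivLin_primitiveLin (φ : TestFun M) :
    derivLin M (primitiveLin M φ) = meanFree M φ := by
  rw [primitiveLin, LinearMap.comp_apply, meanFree_apply (primitiveAux M φ), map_sub, map_smul,
    derivLin_one, smul_zero, sub_zero]
  ext t
  exact (meanFree M φ).continuous.deriv_integral _ 0 t

theorem integralLin_primitiveLin (φ : TestFun M) : integralLin M (primitiveLin M φ) = 0 :=
  integralLin_meanFree _

theorem seminorms_meanFree_le (k : ℕ) (φ : TestFun M) :
    seminorms M k (meanFree M φ) ≤
      seminorms M k φ + seminorms M k (one M) * supSeminorm M φ := by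
  have h : |M⁻¹ * integralLin M φ| ≤ supSeminorm M φ := by
    rw [abs_mul, abs_of_pos (inv_pos.2 hM.out), inv_mul_le_iff₀ hM.out]
    exact abs_integralLin_le φ
  rw [meanFree_apply]
  refine (map_sub_le_add (seminorms M k) _ _).trans (add_le_add_right ?_ _)
  rw [map_smul_eq_mul, Real.norm_eq_abs, mul_comm]
  exact mul_le_mul_of_nonneg_left h (apply_nonneg _ _)

theorem supSeminorm_one : supSeminorm M (one M) = 1 := by
  simp [supSeminorm_apply]

theorem supSeminorm_meanFree_le (φ : TestFun M) :
    supSeminorm M (meanFree M φ) ≤ 2 * supSeminorm M φ := by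
  have := seminorms_meanFree_le 0 φ
  rw [seminorms_zero, seminorms_zero, seminorms_zero, supSeminorm_one] at this
  linarith

theorem supSeminorm_primitiveAux_le (φ : TestFun M) :
    supSeminorm M (primitiveAux M φ) ≤ M * (2 * supSeminorm M φ) := by
  refine ciSup_le fun t => ?_
  obtain ⟨s, hs, hst⟩ := (primitiveAux M φ).periodic.exists_mem_Ico₀ hM.out t
  rw [hst]
  have := intervalIntegral.norm_integral_le_of_norm_le_const (a := 0) (b := s)
    (f := meanFree M φ) (C := supSeminorm M (meanFree M φ))
    (fun t _ => (meanFree M φ).abs_le_supSeminorm t)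
  rw [sub_zero, abs_of_nonneg hs.1, Real.norm_eq_abs, mul_comm] at this
  exact this.trans (mul_le_mul hs.2.le (supSeminorm_meanFree_le φ) (apply_nonneg _ _) hM.out.le)

/-- `primitiveLin` as a continuous linear map of `S(T_M)`. -/
def primitiveCLM (M : ℝ) [Fact (0 < M)] : TestFun M →L[ℝ] TestFun M where
  toLinearMap := primitiveLin M
  cont := WithSeminorms.continuous_of_isBounded (withSeminorms M) (withSeminorms M) _
    (Seminorm.IsBounded.of_real fun k => by
      cases k with
      | zero =>
        refine ⟨{0}, 4 * M, fun φ => ?_⟩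
        simp only [Finset.sup_singleton]
        change supSeminorm M (primitiveLin M φ) ≤ (4 * M) * supSeminorm M φ
        have h1 : supSeminorm M (primitiveLin M φ) ≤ 2 * supSeminorm M (primitiveAux M φ) :=
          supSeminorm_meanFree_le _
        have h2 := supSeminorm_primitiveAux_le φ
        linarith
      | succ k =>
        refine ⟨{k, 0}, 1 + seminorms M k (one M), fun φ => ?_⟩
        have h0 : (seminorms M k φ) ≤ (({k, 0} : Finset ℕ).sup (seminorms M)) φ :=
          Seminorm.le_finset_sup_apply (by simp)
        have h1 : (seminorms M 0 φ) ≤ (({k, 0} : Finset ℕ).sup (seminorms M)) φ :=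
          Seminorm.le_finset_sup_apply (by simp)
        have h2 := seminorms_meanFree_le k φ
        have h3 := mul_le_mul_of_nonneg_left h1 (apply_nonneg (seminorms M k) (one M))
        rw [seminorms_zero] at h3
        change seminorms M (k + 1) (primitiveLin M φ) ≤
          (1 + seminorms M k (one M)) * (({k, 0} : Finset ℕ).sup (seminorms M)) φ
        rw [seminorms_succ, derivLin_primitiveLin]
        linarith)

end TestFun

variable (M : ℝ) [hM : Fact (0 < M)]

/-! ### Periodic distributions, the operators `L` and `L†` -/

/-- The space `S'(T_M)` of real periodic distributions: continuous linear functionals on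
`S(T_M)`, with `w φ = ⟨w, φ⟩`. -/
abbrev Distr : Type := TestFun M →L[ℝ] ℝ

/-- The distributional derivative, `⟨D w, φ⟩ = -⟨w, φ'⟩`. -/
def distrDeriv : Distr M →ₗ[ℝ] Distr M where
  toFun w := -(w.comp (TestFun.derivCLM M))
  map_add' w v := by
    ext φ
    change -(w _ + v _) = -w _ + -v _
    ring
  map_smul' c w := by
    ext φ
    change -(c * w _) = c * -w _
    ring

/-- The operator `L = D^(α+1)` on periodic distributions. -/
def opL (α : ℕ) : Distr M →ₗ[ℝ] Distr M := distrDeriv M ^ (α + 1)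

/-- The pseudoinverse `D†` of `D`, defined by duality. Like its counterpart on test functions, it
multiplies the `k`-th Fourier coefficient by `(2πik/M)⁻¹` for `k ≠ 0` and annihilates the `0`-th
one. -/
def distrPrimitive : Distr M →ₗ[ℝ] Distr M where
  toFun w := -(w.comp (TestFun.primitiveCLM M))
  map_add' w v := by
    ext φ
    change -(w _ + v _) = -w _ + -v _
    ring
  map_smul' c w := by
    ext φ
    change -(c * w _) = c * -w _
    ring

/-- The pseudoinverse `L†` of `L = D^(α+1)`: the Fourier multiplier that multiplies the `k`-th
Fourier coefficient by `(2πik/M)^(-(α+1))` for `k ≠ 0` and annihilates the `0`-th one. -/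
def opLDagger (α : ℕ) : Distr M →ₗ[ℝ] Distr M := distrPrimitive M ^ (α + 1)

/-- The constant function `a`, as the distribution `φ ↦ ∫₀ᴹ a φ(t) dt`. -/
def constDistr (a : ℝ) : Distr M := a • TestFun.integralCLM M

/-- The pairing `w ↦ ⟨w, φ⟩` with a fixed test function. -/
def pairing (φ : TestFun M) : Distr M →ₗ[ℝ] ℝ where
  toFun w := w φ
  map_add' _ _ := rfl
  map_smul' _ _ := rfl

/-! ### The TV norm and the RI-TV norm -/

/-- The mixed norm `sup_t ‖φ(t)‖₂` of a smooth periodic curve `φ = (φ₁, φ₂)`. -/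
def mixedNorm (φ : TestFun M × TestFun M) : ℝ := ⨆ t : ℝ, ‖!₂[φ.1 t, φ.2 t]‖

/-- The total-variation norm of a periodic distribution,
`‖w‖_TV = sup {⟨w, φ⟩ : ‖φ‖_∞ = 1} ∈ [0, ∞]`. -/
def tvNorm (w : Distr M) : EReal :=
  ⨆ (φ : TestFun M) (_ : TestFun.supSeminorm M φ = 1), ((w φ : ℝ) : EReal)

/-- The RI-TV norm, i.e. the (TV-ℓ₂) norm, of a pair of periodic distributions,
`R(w) = sup {⟨w₁, φ₁⟩ + ⟨w₂, φ₂⟩ : ‖φ‖_{2,∞} = 1} ∈ [0, ∞]`. -/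
def ritvNorm (w : Distr M × Distr M) : EReal :=
  ⨆ (φ : TestFun M × TestFun M) (_ : mixedNorm M φ = 1),
    ((w.1 φ.1 + w.2 φ.2 : ℝ) : EReal)

section SupFunctional

/-! The set where a supremum of linear functionals over a symmetric set is finite is a subspace,
and the supremum is a seminorm there. -/

variable {E F : Type*} [AddCommGroup E] [Module ℝ E] [AddCommGroup F] [Module ℝ F]

/-- `sup {B x y : y ∈ S}`. -/
def supOn (B : E →ₗ[ℝ] F →ₗ[ℝ] ℝ) (S : Set F) (x : E) : EReal :=
  ⨆ (y : F) (_ : y ∈ S), ((B x y : ℝ) : EReal)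

variable {B : E →ₗ[ℝ] F →ₗ[ℝ] ℝ} {S : Set F}

theorem supOn_le_iff {x : E} {r : ℝ} : supOn B S x ≤ r ↔ ∀ y ∈ S, B x y ≤ r := by
  simp [supOn, iSup_le_iff, EReal.coe_le_coe_iff]

theorem le_supOn (x : E) {y : F} (hy : y ∈ S) : ((B x y : ℝ) : EReal) ≤ supOn B S x :=
  le_iSup₂_of_le y hy le_rfl

theorem supOn_nonneg (hS : S.Nonempty) (hneg : ∀ y ∈ S, -y ∈ S) (x : E) : 0 ≤ supOn B S x := by
  obtain ⟨y, hy⟩ := hS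
  rcases le_total 0 (B x y) with h | h
  · exact le_trans (EReal.coe_nonneg.2 h) (le_supOn x hy)
  · refine le_trans (EReal.coe_nonneg.2 ?_) (le_supOn x (hneg y hy))
    rw [map_neg]
    linarith

theorem coe_toReal_supOn (hS : S.Nonempty) (hneg : ∀ y ∈ S, -y ∈ S) {x : E}
    (hx : supOn B S x < ⊤) : (((supOn B S x).toReal : ℝ) : EReal) = supOn B S x :=
  EReal.coe_toReal hx.ne (ne_of_gt (lt_of_lt_of_le EReal.bot_lt_zero (supOn_nonneg hS hneg x)))

theorem le_toReal_supOn (hS : S.Nonempty) (hneg : ∀ y ∈ S, -y ∈ S) {x : E}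
    (hx : supOn B S x < ⊤) {y : F} (hy : y ∈ S) : B x y ≤ (supOn B S x).toReal := by
  rw [← EReal.coe_le_coe_iff, coe_toReal_supOn hS hneg hx]
  exact le_supOn x hy

theorem toReal_supOn_le (hS : S.Nonempty) (hneg : ∀ y ∈ S, -y ∈ S) {x : E} {r : ℝ}
    (h : ∀ y ∈ S, B x y ≤ r) : (supOn B S x).toReal ≤ r := by
  have h1 : supOn B S x ≤ r := supOn_le_iff.2 h
  rw [← EReal.coe_le_coe_iff, coe_toReal_supOn hS hneg (lt_of_le_of_lt h1 (EReal.coe_lt_top r))]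
  exact h1

theorem supOn_add_bound (hS : S.Nonempty) (hneg : ∀ y ∈ S, -y ∈ S) {x x' : E}
    (hx : supOn B S x < ⊤) (hx' : supOn B S x' < ⊤) :
    ∀ y ∈ S, B (x + x') y ≤ (supOn B S x).toReal + (supOn B S x').toReal := fun y hy => by
  rw [map_add, LinearMap.add_apply]
  exact add_le_add (le_toReal_supOn hS hneg hx hy) (le_toReal_supOn hS hneg hx' hy)

theorem supOn_smul_bound (hS : S.Nonempty) (hneg : ∀ y ∈ S, -y ∈ S) {x : E}
    (hx : supOn B S x < ⊤) (c : ℝ) :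
    ∀ y ∈ S, B (c • x) y ≤ |c| * (supOn B S x).toReal := fun y hy => by
  have h1 := le_toReal_supOn hS hneg hx hy
  have h2 := le_toReal_supOn hS hneg hx (hneg y hy)
  rw [map_neg] at h2
  rw [map_smul, LinearMap.smul_apply, smul_eq_mul]
  calc c * B x y ≤ |c * B x y| := le_abs_self _
    _ = |c| * |B x y| := abs_mul _ _
    _ ≤ _ := mul_le_mul_of_nonneg_left (abs_le.2 ⟨by linarith, h1⟩) (abs_nonneg c)

/-- The subspace `{x : sup {B x y : y ∈ S} < ∞}`. -/
def finiteSubmodule (B : E →ₗ[ℝ] F →ₗ[ℝ] ℝ) (S : Set F) (hS : S.Nonempty)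
    (hneg : ∀ y ∈ S, -y ∈ S) : Submodule ℝ E where
  carrier := {x | supOn B S x < ⊤}
  add_mem' hx hx' :=
    lt_of_le_of_lt (supOn_le_iff.2 (supOn_add_bound hS hneg hx hx')) (EReal.coe_lt_top _)
  zero_mem' :=
    lt_of_le_of_lt (supOn_le_iff (r := 0).2 fun y _ => by simp) (EReal.coe_lt_top _)
  smul_mem' c _ hx :=
    lt_of_le_of_lt (supOn_le_iff.2 (supOn_smul_bound hS hneg hx c)) (EReal.coe_lt_top _)

/-- The seminorm `x ↦ sup {B x y : y ∈ S}` on the subspace where it is finite. -/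
def finiteSeminorm (B : E →ₗ[ℝ] F →ₗ[ℝ] ℝ) (S : Set F) (hS : S.Nonempty)
    (hneg : ∀ y ∈ S, -y ∈ S) : Seminorm ℝ (finiteSubmodule B S hS hneg) :=
  Seminorm.ofSMulLE (fun x => (supOn B S (x : E)).toReal)
    (le_antisymm (toReal_supOn_le hS hneg fun y _ => by simp)
      (EReal.toReal_nonneg (supOn_nonneg hS hneg _)))
    (fun x x' => toReal_supOn_le hS hneg (supOn_add_bound hS hneg x.2 x'.2))
    (fun c x => toReal_supOn_le hS hneg (supOn_smul_bound hS hneg x.2 c))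

end SupFunctional

/-- The duality pairing on `S'(T_M) × S(T_M)`. -/
def pairingB : Distr M →ₗ[ℝ] TestFun M →ₗ[ℝ] ℝ where
  toFun w := w.toLinearMap
  map_add' _ _ := rfl
  map_smul' _ _ := rfl

/-- The duality pairing on `S'(T_M)² × S(T_M)²`. -/
def pairingB₂ : (Distr M × Distr M) →ₗ[ℝ] (TestFun M × TestFun M) →ₗ[ℝ] ℝ where
  toFun w := w.1.toLinearMap.coprod w.2.toLinearMap
  map_add' w v := by
    ext φ <;> simp
  map_smul' c w := by
    ext φ <;> simp

theorem tvNorm_eq_supOn (w : Distr M) :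
    tvNorm M w = supOn (pairingB M) {φ | TestFun.supSeminorm M φ = 1} w := rfl

theorem ritvNorm_eq_supOn (w : Distr M × Distr M) :
    ritvNorm M w = supOn (pairingB₂ M) {φ | mixedNorm M φ = 1} w := rfl

theorem unitSphere_nonempty : {φ | TestFun.supSeminorm M φ = 1}.Nonempty :=
  ⟨TestFun.one M, TestFun.supSeminorm_one⟩

theorem unitSphere_neg :
    ∀ φ ∈ {φ | TestFun.supSeminorm M φ = 1}, -φ ∈ {φ | TestFun.supSeminorm M φ = 1} :=
  fun φ hφ => by
    change TestFun.supSeminorm M (-φ) = 1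
    rw [map_neg_eq_map]
    exact hφ

theorem mixedSphere_nonempty : {φ | mixedNorm M φ = 1}.Nonempty :=
  ⟨(TestFun.one M, 0), by simp [mixedNorm, EuclideanSpace.norm_eq]⟩

theorem mixedSphere_neg : ∀ φ ∈ {φ | mixedNorm M φ = 1}, -φ ∈ {φ | mixedNorm M φ = 1} :=
  fun φ hφ => by
    have h : mixedNorm M (-φ) = mixedNorm M φ := by
      simp [mixedNorm, EuclideanSpace.norm_eq]
    exact h.trans hφ

/-- The subspace of periodic distributions of finite TV norm. -/
def finiteTV : Submodule ℝ (Distr M) :=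
  (finiteSubmodule (pairingB M) _ (unitSphere_nonempty M) (unitSphere_neg M)).copy
    {w | tvNorm M w < ⊤} rfl

/-- The subspace of pairs of periodic distributions of finite RI-TV norm. -/
def finiteRITV : Submodule ℝ (Distr M × Distr M) :=
  (finiteSubmodule (pairingB₂ M) _ (mixedSphere_nonempty M) (mixedSphere_neg M)).copy
    {w | ritvNorm M w < ⊤} rfl

/-- `w ↦ ‖w‖_TV` as a seminorm on the distributions of finite TV norm. -/
def tvSeminorm : Seminorm ℝ (finiteTV M) :=
  finiteSeminorm (pairingB M) _ (unitSphere_nonempty M) (unitSphere_neg M)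

/-- `w ↦ R(w)` as a seminorm on the pairs of distributions of finite RI-TV norm. -/
def ritvSeminorm : Seminorm ℝ (finiteRITV M) :=
  finiteSeminorm (pairingB₂ M) _ (mixedSphere_nonempty M) (mixedSphere_neg M)

theorem tvSeminorm_apply (w : finiteTV M) : tvSeminorm M w = (tvNorm M w).toReal := rfl

theorem ritvSeminorm_apply (w : finiteRITV M) : ritvSeminorm M w = (ritvNorm M w).toReal := rfl

/-! ### Periodic Radon measures -/

/-- `w` is given by a periodic finite Radon measure, i.e. by a finite signed Borel measure on the
circle `ℝ/Mℤ`, written as a difference `μ - ν` of finite positive Borel measures. -/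
def IsRadon (w : Distr M) : Prop :=
  ∃ μ ν : Measure (AddCircle M), IsFiniteMeasure μ ∧ IsFiniteMeasure ν ∧
    ∀ φ : TestFun M, w φ = (∫ x, φ.periodic.lift x ∂μ) - ∫ x, φ.periodic.lift x ∂ν

variable {M} in
theorem TestFun.continuous_lift (φ : TestFun M) : Continuous φ.periodic.lift :=
  continuous_coinduced_dom.2 φ.continuous

variable {M} in
theorem TestFun.integrable_lift (φ : TestFun M) (μ : Measure (AddCircle M)) [IsFiniteMeasure μ] :
    Integrable φ.periodic.lift μ :=
  φ.continuous_lift.integrable_of_hasCompactSupport (HasCompactSupport.of_compactSpace _)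

/-- The space `M(T_M)` of periodic finite Radon measures, as a subspace of `S'(T_M)`. -/
def radonMeasures : Submodule ℝ (Distr M) where
  carrier := {w | IsRadon M w}
  add_mem' := by
    rintro w w' ⟨μ, ν, hμ, hν, h⟩ ⟨μ', ν', hμ', hν', h'⟩
    refine ⟨μ + μ', ν + ν', inferInstance, inferInstance, fun φ => ?_⟩
    rw [integral_add_measure (φ.integrable_lift _) (φ.integrable_lift _),
      integral_add_measure (φ.integrable_lift _) (φ.integrable_lift _)]
    change w φ + w' φ = _
    rw [h, h']
    ring
  zero_mem' := ⟨0, 0, inferInstance, inferInstance, fun φ => by simp⟩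
  smul_mem' := by
    rintro c w ⟨μ, ν, hμ, hν, h⟩
    rcases le_total 0 c with hc | hc
    · refine ⟨c.toNNReal • μ, c.toNNReal • ν, inferInstance, inferInstance, fun φ => ?_⟩
      rw [integral_smul_nnreal_measure, integral_smul_nnreal_measure]
      change c * w φ = _
      rw [h, NNReal.smul_def, NNReal.smul_def, Real.coe_toNNReal c hc, smul_eq_mul, smul_eq_mul]
      ring
    · refine ⟨(-c).toNNReal • ν, (-c).toNNReal • μ, inferInstance, inferInstance, fun φ => ?_⟩
      rw [integral_smul_nnreal_measure, integral_smul_nnreal_measure]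
      change c * w φ = _
      rw [h, NNReal.smul_def, NNReal.smul_def, Real.coe_toNNReal (-c) (by linarith),
        smul_eq_mul, smul_eq_mul]
      ring

/-- The space `M₀(T_M)` of periodic Radon measures of zero mean, `⟨w, 1⟩ = 0`. -/
def radonMeasures₀ : Submodule ℝ (Distr M) :=
  radonMeasures M ⊓ LinearMap.ker (pairing M (TestFun.one M))

theorem radonMeasures₀_le_finiteTV : radonMeasures₀ M ≤ finiteTV M := by
  rintro w ⟨⟨μ, ν, hμ, hν, h⟩, -⟩
  have key : ∀ φ ∈ {φ | TestFun.supSeminorm M φ = 1},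
      pairingB M w φ ≤ μ.real Set.univ + ν.real Set.univ := fun φ hφ => by
    have hb : ∀ x, ‖φ.periodic.lift x‖ ≤ 1 := fun x => by
      obtain ⟨t, rfl⟩ := QuotientAddGroup.mk_surjective x
      have := φ.abs_le_supSeminorm t
      rw [show TestFun.supSeminorm M φ = 1 from hφ] at this
      exact this
    have h1 := norm_integral_le_of_norm_le_const (μ := μ) (Filter.Eventually.of_forall hb)
    have h2 := norm_integral_le_of_norm_le_const (μ := ν) (Filter.Eventually.of_forall hb)
    rw [Real.norm_eq_abs, one_mul] at h1 h2
    change w φ ≤ _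
    rw [h]
    linarith [(abs_le.1 h1).2, (abs_le.1 h2).1]
  exact lt_of_le_of_lt (supOn_le_iff.2 key) (EReal.coe_lt_top _)

theorem le_toReal_tvNorm {w : Distr M} (hw : tvNorm M w < ⊤) {φ : TestFun M}
    (hφ : TestFun.supSeminorm M φ = 1) : w φ ≤ (tvNorm M w).toReal :=
  le_toReal_supOn (B := pairingB M) (x := w) (y := φ) (unitSphere_nonempty M) (unitSphere_neg M)
    hw hφ

theorem eq_zero_of_tvSeminorm_eq_zero (w : finiteTV M) (h : tvSeminorm M w = 0) : w = 0 := by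
  have key : ∀ φ : TestFun M, (w : Distr M) φ ≤ 0 := fun φ => by
    by_cases h0 : TestFun.supSeminorm M φ = 0
    · have : φ = 0 := TestFun.ext fun t => by
        have := φ.abs_le_supSeminorm t
        rw [h0] at this
        simpa using this
      rw [this, map_zero]
    · have hpos : 0 < TestFun.supSeminorm M φ := lt_of_le_of_ne (apply_nonneg _ _) (Ne.symm h0)
      have h1 : TestFun.supSeminorm M ((TestFun.supSeminorm M φ)⁻¹ • φ) = 1 := by
        rw [map_smul_eq_mul, Real.norm_eq_abs, abs_of_pos (inv_pos.2 hpos), inv_mul_cancel₀ h0]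
      have h3 := le_toReal_tvNorm M w.2 h1
      rw [← tvSeminorm_apply, h, map_smul, smul_eq_mul] at h3
      by_contra! hc
      exact absurd h3 (not_le.2 (mul_pos (inv_pos.2 hpos) hc))
  ext φ
  refine le_antisymm (key φ) ?_
  have := key (-φ)
  rw [map_neg] at this
  change 0 ≤ _
  linarith

/-- The normed space `M₀(T_M)` (a type synonym, so that it carries no topology but that of the TV
norm). -/
def MeanZeroMeasure : Type := ↥(radonMeasures₀ M)

namespace MeanZeroMeasure

instance : AddCommGroup (MeanZeroMeasure M) := inferInstanceAs (AddCommGroup ↥(radonMeasures₀ M))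

instance : Module ℝ (MeanZeroMeasure M) := inferInstanceAs (Module ℝ ↥(radonMeasures₀ M))

/-- The inclusion `M₀(T_M) ⊆ S'(T_M)`. -/
def toDistr : MeanZeroMeasure M →ₗ[ℝ] Distr M := (radonMeasures₀ M).subtype

/-- The TV norm on `M₀(T_M)`. -/
def seminorm : Seminorm ℝ (MeanZeroMeasure M) :=
  (tvSeminorm M).comp (Submodule.inclusion (radonMeasures₀_le_finiteTV M))

instance : NormedAddCommGroup (MeanZeroMeasure M) :=
  AddGroupNorm.toNormedAddCommGroup
    { (seminorm M).toAddGroupSeminorm with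
      eq_zero_of_map_eq_zero' := fun _ hw => Submodule.inclusion_injective
        (radonMeasures₀_le_finiteTV M) (eq_zero_of_tvSeminorm_eq_zero M _ hw) }

instance : NormedSpace ℝ (MeanZeroMeasure M) where
  norm_smul_le c w := le_of_eq (map_smul_eq_mul (seminorm M) c w)

theorem norm_def (w : MeanZeroMeasure M) : ‖w‖ = (tvNorm M (toDistr M w)).toReal := rfl

end MeanZeroMeasure

/-! ### The native space and the search space -/

/-- The native space `M_L(T_M) = {f ∈ S'(T_M) : ‖L f‖_TV < ∞}`. -/
def nativeSpace (α : ℕ) : Submodule ℝ (Distr M) :=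
  ((finiteTV M).comap (opL M α)).copy {f | tvNorm M (opL M α f) < ⊤} rfl

/-- The search space `X_L(T_M) = {r ∈ S'(T_M)² : R(L r) < ∞}`, where `L r = (L r₁, L r₂)`. -/
def searchSpace (α : ℕ) : Submodule ℝ (Distr M × Distr M) :=
  ((finiteRITV M).comap ((opL M α).prodMap (opL M α))).copy
    {r | ritvNorm M (opL M α r.1, opL M α r.2) < ⊤} rfl

/-- `M_L(T_M)` as a (semi)normed space, `‖f‖ = ‖L f‖_TV + |⟨f, 1⟩|` (a type synonym, so that it
carries no other topology). -/
def NativeSpace (α : ℕ) : Type := ↥(nativeSpace M α)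

namespace NativeSpace

variable (α : ℕ)

instance : AddCommGroup (NativeSpace M α) := inferInstanceAs (AddCommGroup ↥(nativeSpace M α))

instance : Module ℝ (NativeSpace M α) := inferInstanceAs (Module ℝ ↥(nativeSpace M α))

/-- The inclusion `M_L(T_M) ⊆ S'(T_M)`. -/
def toDistr : NativeSpace M α →ₗ[ℝ] Distr M := (nativeSpace M α).subtype

/-- `f ↦ ‖L f‖_TV + |⟨f, 1⟩|`. -/
def seminorm : Seminorm ℝ (NativeSpace M α) :=
  (tvSeminorm M).comp ((opL M α).restrict (p := nativeSpace M α) (q := finiteTV M) fun _ h => h) +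
    (normSeminorm ℝ ℝ).comp (pairing M (TestFun.one M) ∘ₗ toDistr M α)

instance : SeminormedAddCommGroup (NativeSpace M α) :=
  AddGroupSeminorm.toSeminormedAddCommGroup (seminorm M α).toAddGroupSeminorm

instance : NormedSpace ℝ (NativeSpace M α) where
  norm_smul_le c w := le_of_eq (map_smul_eq_mul (seminorm M α) c w)

theorem norm_def (f : NativeSpace M α) :
    ‖f‖ = (tvNorm M (opL M α (toDistr M α f))).toReal + |toDistr M α f (TestFun.one M)| := rfl

end NativeSpace

/-- `X_L(T_M)` as a (semi)normed space, `‖r‖ = R(L r) + ‖(⟨r₁, 1⟩, ⟨r₂, 1⟩)‖_∞` (a type synonym, so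
that it carries no other topology). -/
def SearchSpace (α : ℕ) : Type := ↥(searchSpace M α)

namespace SearchSpace

variable (α : ℕ)

instance : AddCommGroup (SearchSpace M α) := inferInstanceAs (AddCommGroup ↥(searchSpace M α))

instance : Module ℝ (SearchSpace M α) := inferInstanceAs (Module ℝ ↥(searchSpace M α))

/-- The inclusion `X_L(T_M) ⊆ S'(T_M)²`. -/
def toDistr : SearchSpace M α →ₗ[ℝ] Distr M × Distr M := (searchSpace M α).subtype

/-- `r ↦ R(L r) + ‖(⟨r₁, 1⟩, ⟨r₂, 1⟩)‖_∞`. -/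
def seminorm : Seminorm ℝ (SearchSpace M α) :=
  (ritvSeminorm M).comp (((opL M α).prodMap (opL M α)).restrict (p := searchSpace M α)
      (q := finiteRITV M) fun _ h => h) +
    (normSeminorm ℝ (ℝ × ℝ)).comp
      ((pairing M (TestFun.one M)).prodMap (pairing M (TestFun.one M)) ∘ₗ toDistr M α)

instance : SeminormedAddCommGroup (SearchSpace M α) :=
  AddGroupSeminorm.toSeminormedAddCommGroup (seminorm M α).toAddGroupSeminorm

instance : NormedSpace ℝ (SearchSpace M α) where
  norm_smul_le c w := le_of_eq (map_smul_eq_mul (seminorm M α) c w)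

theorem norm_def (r : SearchSpace M α) :
    ‖r‖ = (ritvNorm M (opL M α (toDistr M α r).1, opL M α (toDistr M α r).2)).toReal +
      ‖((toDistr M α r).1 (TestFun.one M), (toDistr M α r).2 (TestFun.one M))‖ := rfl

end SearchSpace

end PeriodicCurve

end

open PeriodicCurve

/-!
The Euclidean norm on `ℝ²` lies between the maximum and sum norms, so
`max ‖wᵢ‖_TV ≤ R(w) ≤ ‖w₁‖_TV + ‖w₂‖_TV`; this identifies `X_L` with `M_L × M_L`, and reduces the
assertion on `T_L` to the scalar map `f ↦ (L f, ⟨f, 1⟩)`. By duality, `D D† = D† D` is the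
projection `w ↦ w - ⟨w, 1⟩ / M`, because the same holds for the derivative and the periodic
primitive of test functions, and this projection is idempotent, so `L L† = L† L` is the same
projection. Hence `(w, a) ↦ L† w + a / M` inverts the scalar map as soon as `L f` is a measure
whenever `‖L f‖_TV < ∞`. This last point is the Riesz representation theorem on the circle, combined
with the splitting of a bounded functional on a normed lattice into positive ones.
-/

noncomputable section

namespace PeriodicCurve

section BoundedFunctional

variable {V E : Type*} [AddCommGroup V] [Module ℝ V]

theorem exists_comp_eq_of_le_sublinear [AddCommGroup E] [Module ℝ E] {N : E → ℝ}
    (N_hom : ∀ c : ℝ, 0 < c → ∀ x, N (c • x) = c * N x) (N_add : ∀ x y, N (x + y) ≤ N x + N y)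
    (d : V →ₗ[ℝ] E) {F : V →ₗ[ℝ] ℝ} (hF : ∀ v, F v ≤ N (d v)) :
    ∃ G : E →ₗ[ℝ] ℝ, G ∘ₗ d = F ∧ ∀ x, G x ≤ N x := by
  have N_zero : N 0 = 0 := by
    have h := N_hom 2 two_pos 0
    rw [smul_zero] at h
    linarith
  have F_nonpos_of_mem_ker : ∀ v ∈ LinearMap.ker d, F v ≤ 0 := fun v hv =>
    (hF v).trans_eq (by rw [LinearMap.mem_ker.1 hv, N_zero])
  have ker_le : LinearMap.ker d ≤ LinearMap.ker F := fun v hv => by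
    have h := F_nonpos_of_mem_ker (-v) (neg_mem hv)
    rw [map_neg, neg_nonpos] at h
    exact (F_nonpos_of_mem_ker v hv).antisymm h
  let f : LinearMap.range d →ₗ[ℝ] ℝ := (LinearMap.ker d).liftQ F ker_le ∘ₗ d.quotKerEquivRange.symm
  have f_apply : ∀ v, f ⟨d v, v, rfl⟩ = F v := fun v => by
    simp only [f, LinearMap.comp_apply, LinearEquiv.coe_coe]
    rw [LinearMap.quotKerEquivRange_symm_apply_image d v ⟨v, rfl⟩, Submodule.mkQ_apply,
      Submodule.liftQ_apply]
  obtain ⟨G, G_eq, G_le⟩ := exists_extension_of_le_sublinear ⟨LinearMap.range d, f⟩ N N_hom N_add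
    (by rintro ⟨_, v, rfl⟩; exact (f_apply v).trans_le (hF v))
  exact ⟨G, LinearMap.ext fun v => (G_eq ⟨d v, v, rfl⟩).trans (f_apply v), G_le⟩

section NormedLattice

variable [NormedAddCommGroup E] [Lattice E]

theorem posPart_smul_of_pos [NormedSpace ℝ E] [PosSMulMono ℝ E] {c : ℝ} (hc : 0 < c) (x : E) :
    (c • x)⁺ = c • x⁺ := by
  have h := (OrderIso.smulRight (β := E) hc).map_sup x 0
  rw [OrderIso.smulRight_apply, OrderIso.smulRight_apply, OrderIso.smulRight_apply, smul_zero] at h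
  exact h.symm

variable [IsOrderedAddMonoid E]

theorem norm_posPart_add_posPart_add_le [HasSolidNorm E] (x y x' y' : E) :
    ‖(x + x')⁺ + (y + y')⁺‖ ≤ ‖x⁺ + y⁺‖ + ‖x'⁺ + y'⁺‖ := by
  have posPart_add_le : ∀ a b : E, (a + b)⁺ ≤ a⁺ + b⁺ := fun a b =>
    sup_le (add_le_add (le_posPart a) (le_posPart b))
      (add_nonneg (posPart_nonneg a) (posPart_nonneg b))
  refine (norm_le_norm_of_abs_le_abs ?_).trans (norm_add_le _ _)
  rw [abs_of_nonneg (by positivity), abs_of_nonneg (by positivity), add_add_add_comm]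
  exact add_le_add (posPart_add_le x x') (posPart_add_le y y')

theorem exists_positiveLinearMap_sub_of_le_norm [HasSolidNorm E] [NormedSpace ℝ E]
    [PosSMulMono ℝ E] (j : V →ₗ[ℝ] E) {F : V →ₗ[ℝ] ℝ} {C : ℝ} (hC : 0 ≤ C)
    (hF : ∀ v, F v ≤ C * ‖j v‖) :
    ∃ P Q : E →ₚ[ℝ] ℝ, ∀ v, F v = P (j v) - Q (j v) := by
  -- A functional dominated by `(x, y) ↦ C ‖x⁺ + y⁺‖` is nonnegative on the positive cone of
  -- `E × E`, while on the antidiagonal `{(x, -x)}` this bound is `C ‖x‖`.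
  obtain ⟨G, G_eq, G_le⟩ := exists_comp_eq_of_le_sublinear (E := E × E)
    (N := fun p => C * ‖p.1⁺ + p.2⁺‖)
    (fun c hc p => by
      rw [Prod.smul_fst, Prod.smul_snd, posPart_smul_of_pos hc, posPart_smul_of_pos hc, ← smul_add,
        norm_smul, Real.norm_of_nonneg hc.le, mul_left_comm])
    (fun p q => by
      rw [← mul_add]
      exact mul_le_mul_of_nonneg_left (norm_posPart_add_posPart_add_le _ _ _ _) hC)
    (j.prod (-j)) (F := F)
    (fun v => (hF v).trans_eq (by
      change _ = C * ‖(j v)⁺ + (-j v)⁺‖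
      rw [posPart_neg, posPart_add_negPart, norm_abs_eq_norm]))
  have G_nonneg : ∀ x y : E, 0 ≤ x → 0 ≤ y → 0 ≤ G (x, y) := fun x y hx hy => by
    have h := G_le (-(x, y))
    rw [map_neg, Prod.neg_mk, posPart_neg, posPart_neg, negPart_of_nonneg hx, negPart_of_nonneg hy,
      add_zero, norm_zero, mul_zero] at h
    exact neg_nonpos.1 h
  refine ⟨.mk₀ (G ∘ₗ LinearMap.inl ℝ E E) fun x hx => G_nonneg x 0 hx le_rfl,
    .mk₀ (G ∘ₗ LinearMap.inr ℝ E E) fun y hy => G_nonneg 0 y le_rfl hy, fun v => ?_⟩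
  calc F v = G (j v, -j v) := (DFunLike.congr_fun G_eq v).symm
    _ = G (j v, 0) - G (0, j v) := by
      rw [← map_sub, Prod.mk_sub_mk, sub_zero, zero_sub]

end NormedLattice

section CompactSpace

variable {X : Type*} [TopologicalSpace X] [CompactSpace X]

instance : HasSolidNorm C(X, ℝ) where
  solid f g h := (ContinuousMap.norm_le f (norm_nonneg g)).2 fun x =>
    (h x).trans (g.norm_coe_le_norm x)

variable [T2Space X] [MeasurableSpace X] [BorelSpace X]

theorem exists_isFiniteMeasure_forall_eq_integral (P : C(X, ℝ) →ₚ[ℝ] ℝ) :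
    ∃ μ : Measure X, IsFiniteMeasure μ ∧ ∀ f : C(X, ℝ), P f = ∫ x, f x ∂μ := by
  let Λ : CompactlySupportedContinuousMap X ℝ →ₚ[ℝ] ℝ := .mk₀
    { toFun := fun g => P g.toContinuousMap
      map_add' := fun _ _ => map_add P _ _
      map_smul' := fun _ _ => map_smul P _ _ }
    fun _ hg => map_nonneg P hg
  exact ⟨RealRMK.rieszMeasure Λ, inferInstance, fun f =>
    (RealRMK.integral_rieszMeasure Λ ⟨f, .of_compactSpace _⟩).symm⟩

theorem exists_isFiniteMeasure_forall_eq_integral_sub (j : V →ₗ[ℝ] C(X, ℝ)) {F : V →ₗ[ℝ] ℝ}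
    {C : ℝ} (hC : 0 ≤ C) (hF : ∀ v, F v ≤ C * ‖j v‖) :
    ∃ μ ν : Measure X, IsFiniteMeasure μ ∧ IsFiniteMeasure ν ∧
      ∀ v, F v = (∫ x, j v x ∂μ) - ∫ x, j v x ∂ν := by
  obtain ⟨P, Q, F_eq⟩ := exists_positiveLinearMap_sub_of_le_norm j hC hF
  obtain ⟨μ, hμ, P_eq⟩ := exists_isFiniteMeasure_forall_eq_integral P
  obtain ⟨ν, hν, Q_eq⟩ := exists_isFiniteMeasure_forall_eq_integral Q
  exact ⟨μ, ν, hμ, hν, fun v => by rw [F_eq, P_eq, Q_eq]⟩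

end CompactSpace

end BoundedFunctional

namespace TestFun

variable {M : ℝ}

theorem differentiable (φ : TestFun M) : Differentiable ℝ φ :=
  (contDiff_infty_iff_deriv.1 φ.contDiff).1

theorem integralLin_derivLin (φ : TestFun M) : integralLin M (derivLin M φ) = 0 :=
  calc ∫ t in (0 : ℝ)..M, deriv φ t = φ M - φ 0 :=
      intervalIntegral.integral_deriv_eq_sub (fun t _ => φ.differentiable t)
        ((derivLin M φ).intervalIntegrable 0 M)
    _ = 0 := by rw [φ.periodic.eq, sub_self]

theorem meanFree_eq_self {φ : TestFun M} (h : integralLin M φ = 0) : meanFree M φ = φ := by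
  rw [meanFree_apply, h, mul_zero, zero_smul, sub_zero]

theorem derivLin_meanFree (φ : TestFun M) : derivLin M (meanFree M φ) = derivLin M φ := by
  rw [meanFree_apply, map_sub, map_smul, derivLin_one, smul_zero, sub_zero]

theorem eq_smul_one_of_derivLin_eq_zero {φ : TestFun M} (h : derivLin M φ = 0) :
    φ = φ 0 • one M := by
  ext t
  rw [smul_apply, one_apply, mul_one]
  exact is_const_of_deriv_eq_zero φ.differentiable (DFunLike.congr_fun h) t 0

variable [hM : Fact (0 < M)]

theorem eq_of_derivLin_eq {φ ψ : TestFun M} (hderiv : derivLin M φ = derivLin M ψ)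
    (hint : integralLin M φ = integralLin M ψ) : φ = ψ := by
  have sub_eq : φ - ψ = (φ - ψ) 0 • one M :=
    eq_smul_one_of_derivLin_eq_zero (by rw [map_sub, hderiv, sub_self])
  have integral_eq : (φ - ψ) 0 * M = 0 :=
    calc (φ - ψ) 0 * M = integralLin M ((φ - ψ) 0 • one M) := by
          rw [map_smul, integralLin_one, smul_eq_mul]
      _ = 0 := by rw [← sub_eq, map_sub, hint, sub_self]
  rw [(mul_eq_zero.1 integral_eq).resolve_right hM.out.ne', zero_smul] at sub_eq
  exact sub_eq_zero.1 sub_eq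

theorem primitiveLin_derivLin (φ : TestFun M) :
    primitiveLin M (derivLin M φ) = meanFree M φ := by
  refine eq_of_derivLin_eq ?_ ?_
  · rw [derivLin_primitiveLin, derivLin_meanFree, meanFree_eq_self (integralLin_derivLin φ)]
  · rw [integralLin_primitiveLin, integralLin_meanFree]

theorem primitiveLin_one : primitiveLin M (one M) = 0 := by
  refine eq_of_derivLin_eq ?_ ?_
  · rw [derivLin_primitiveLin, meanFree_apply, integralLin_one, inv_mul_cancel₀ hM.out.ne',
      one_smul, sub_self, map_zero]
  · rw [integralLin_primitiveLin, map_zero]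

theorem eq_zero_of_supSeminorm_eq_zero {φ : TestFun M} (h : supSeminorm M φ = 0) : φ = 0 :=
  TestFun.ext fun t => abs_nonpos_iff.1 (h ▸ φ.abs_le_supSeminorm t)

/-- The inclusion of `S(T_M)` into the continuous functions on the circle `ℝ/Mℤ`. -/
def toContinuousMap (M : ℝ) [Fact (0 < M)] : TestFun M →ₗ[ℝ] C(AddCircle M, ℝ) where
  toFun φ := ⟨φ.periodic.lift, φ.continuous_lift⟩
  map_add' _ _ := ContinuousMap.ext <| QuotientAddGroup.mk_surjective.forall.2 fun _ => rfl
  map_smul' _ _ := ContinuousMap.ext <| QuotientAddGroup.mk_surjective.forall.2 fun _ => rfl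

theorem supSeminorm_le_norm_toContinuousMap (φ : TestFun M) :
    supSeminorm M φ ≤ ‖toContinuousMap M φ‖ :=
  ciSup_le fun t => (toContinuousMap M φ).norm_coe_le_norm t

end TestFun

section Norms

variable {M : ℝ} [hM : Fact (0 < M)]

theorem tvNorm_nonneg (w : Distr M) : 0 ≤ tvNorm M w :=
  supOn_nonneg (B := pairingB M) (unitSphere_nonempty M) (unitSphere_neg M) w

theorem tvNorm_ne_bot (w : Distr M) : tvNorm M w ≠ ⊥ :=
  (EReal.bot_lt_zero.trans_le (tvNorm_nonneg w)).ne'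

theorem apply_le_toReal_tvNorm_mul_supSeminorm {w : Distr M} (hw : tvNorm M w < ⊤)
    (φ : TestFun M) : w φ ≤ (tvNorm M w).toReal * TestFun.supSeminorm M φ := by
  rcases (apply_nonneg (TestFun.supSeminorm M) φ).eq_or_lt with hzero | hpos
  · rw [TestFun.eq_zero_of_supSeminorm_eq_zero hzero.symm, map_zero, map_zero, mul_zero]
  · have normalized : TestFun.supSeminorm M ((TestFun.supSeminorm M φ)⁻¹ • φ) = 1 := by
      rw [map_smul_eq_mul, norm_inv, Real.norm_of_nonneg hpos.le, inv_mul_cancel₀ hpos.ne']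
    have h := le_toReal_tvNorm M hw normalized
    rwa [map_smul, smul_eq_mul, inv_mul_le_iff₀ hpos, mul_comm] at h

theorem isRadon_of_tvNorm_lt_top {w : Distr M} (hw : tvNorm M w < ⊤) : IsRadon M w :=
  have toReal_nonneg := EReal.toReal_nonneg (tvNorm_nonneg w)
  exists_isFiniteMeasure_forall_eq_integral_sub (TestFun.toContinuousMap M) (F := w.toLinearMap)
    toReal_nonneg fun φ => (apply_le_toReal_tvNorm_mul_supSeminorm hw φ).trans
      (mul_le_mul_of_nonneg_left φ.supSeminorm_le_norm_toContinuousMap toReal_nonneg)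

theorem apply_le_tvNorm (w : Distr M) {φ : TestFun M} (hφ : TestFun.supSeminorm M φ ≤ 1) :
    ((w φ : ℝ) : EReal) ≤ tvNorm M w := by
  rcases eq_or_lt_of_le (le_top (a := tvNorm M w)) with htop | hw
  · exact htop ▸ le_top
  · have real_le : w φ ≤ (tvNorm M w).toReal :=
      (apply_le_toReal_tvNorm_mul_supSeminorm hw φ).trans
        (mul_le_of_le_one_right (EReal.toReal_nonneg (tvNorm_nonneg w)) hφ)
    exact (EReal.coe_le_coe_iff.2 real_le).trans (EReal.coe_toReal_le (tvNorm_ne_bot w))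

theorem mixedNorm_fst_zero (φ : TestFun M) : mixedNorm M (φ, 0) = TestFun.supSeminorm M φ := by
  simp [mixedNorm, EuclideanSpace.norm_eq, TestFun.supSeminorm_apply, Real.sqrt_sq_eq_abs]

theorem mixedNorm_zero_snd (φ : TestFun M) : mixedNorm M (0, φ) = TestFun.supSeminorm M φ := by
  simp [mixedNorm, EuclideanSpace.norm_eq, TestFun.supSeminorm_apply, Real.sqrt_sq_eq_abs]

theorem norm_le_mixedNorm (φ : TestFun M × TestFun M) (t : ℝ) :
    ‖!₂[φ.1 t, φ.2 t]‖ ≤ mixedNorm M φ := by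
  have periodic : Function.Periodic (fun t => ‖!₂[φ.1 t, φ.2 t]‖) M := fun t => by
    simp only [φ.1.periodic t, φ.2.periodic t]
  have continuous : Continuous fun t => ‖!₂[φ.1 t, φ.2 t]‖ := by
    have h₁ := φ.1.continuous
    have h₂ := φ.2.continuous
    simp only [EuclideanSpace.norm_eq, Fin.sum_univ_two]
    fun_prop
  exact le_ciSup (periodic.isBounded_of_continuous hM.out.ne' continuous).bddAbove t

theorem supSeminorm_fst_le_mixedNorm (φ : TestFun M × TestFun M) :
    TestFun.supSeminorm M φ.1 ≤ mixedNorm M φ :=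
  ciSup_le fun t => (PiLp.norm_apply_le !₂[φ.1 t, φ.2 t] 0).trans (norm_le_mixedNorm φ t)

theorem supSeminorm_snd_le_mixedNorm (φ : TestFun M × TestFun M) :
    TestFun.supSeminorm M φ.2 ≤ mixedNorm M φ :=
  ciSup_le fun t => (PiLp.norm_apply_le !₂[φ.1 t, φ.2 t] 1).trans (norm_le_mixedNorm φ t)

theorem tvNorm_fst_le_ritvNorm (w : Distr M × Distr M) : tvNorm M w.1 ≤ ritvNorm M w :=
  iSup₂_le fun φ hφ => le_iSup₂_of_le (φ, 0) ((mixedNorm_fst_zero φ).trans hφ) (by simp)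

theorem tvNorm_snd_le_ritvNorm (w : Distr M × Distr M) : tvNorm M w.2 ≤ ritvNorm M w :=
  iSup₂_le fun φ hφ => le_iSup₂_of_le (0, φ) ((mixedNorm_zero_snd φ).trans hφ) (by simp)

theorem ritvNorm_le_tvNorm_add_tvNorm (w : Distr M × Distr M) :
    ritvNorm M w ≤ tvNorm M w.1 + tvNorm M w.2 :=
  iSup₂_le fun φ hφ => (EReal.coe_add _ _).trans_le <| add_le_add
    (apply_le_tvNorm w.1 ((supSeminorm_fst_le_mixedNorm φ).trans_eq hφ))
    (apply_le_tvNorm w.2 ((supSeminorm_snd_le_mixedNorm φ).trans_eq hφ))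

theorem ritvNorm_lt_top_iff {w : Distr M × Distr M} :
    ritvNorm M w < ⊤ ↔ tvNorm M w.1 < ⊤ ∧ tvNorm M w.2 < ⊤ :=
  ⟨fun h => ⟨(tvNorm_fst_le_ritvNorm w).trans_lt h, (tvNorm_snd_le_ritvNorm w).trans_lt h⟩,
    fun h => (ritvNorm_le_tvNorm_add_tvNorm w).trans_lt (EReal.add_lt_top h.1.ne h.2.ne)⟩

theorem toReal_tvNorm_fst_le_ritvNorm {w : Distr M × Distr M} (h : ritvNorm M w < ⊤) :
    (tvNorm M w.1).toReal ≤ (ritvNorm M w).toReal :=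
  EReal.toReal_le_toReal (tvNorm_fst_le_ritvNorm w) (tvNorm_ne_bot _) h.ne

theorem toReal_tvNorm_snd_le_ritvNorm {w : Distr M × Distr M} (h : ritvNorm M w < ⊤) :
    (tvNorm M w.2).toReal ≤ (ritvNorm M w).toReal :=
  EReal.toReal_le_toReal (tvNorm_snd_le_ritvNorm w) (tvNorm_ne_bot _) h.ne

theorem toReal_ritvNorm_le_tvNorm_add_tvNorm {w : Distr M × Distr M} (h : ritvNorm M w < ⊤) :
    (ritvNorm M w).toReal ≤ (tvNorm M w.1).toReal + (tvNorm M w.2).toReal := by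
  obtain ⟨h₁, h₂⟩ := ritvNorm_lt_top_iff.1 h
  have ritvNorm_ne_bot : ritvNorm M w ≠ ⊥ := fun hbot =>
    tvNorm_ne_bot w.1 (le_bot_iff.1 (hbot ▸ tvNorm_fst_le_ritvNorm w))
  rw [← EReal.toReal_add h₁.ne (tvNorm_ne_bot _) h₂.ne (tvNorm_ne_bot _)]
  exact EReal.toReal_le_toReal (ritvNorm_le_tvNorm_add_tvNorm w) ritvNorm_ne_bot
    (EReal.add_lt_top h₁.ne h₂.ne).ne

end Norms

section Pseudoinverse

variable (M : ℝ) [hM : Fact (0 < M)]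

/-- The projection `w ↦ w - M⁻¹ ⟨w, 1⟩` onto the periodic distributions of zero mean, dual to
`TestFun.meanFree`. -/
def distrMeanFree : Distr M →ₗ[ℝ] Distr M :=
  LinearMap.id - (M⁻¹ • pairing M (TestFun.one M)).smulRight (TestFun.integralCLM M)

variable {M}

theorem distrMeanFree_eq_sub_constDistr (w : Distr M) :
    distrMeanFree M w = w - constDistr M (w (TestFun.one M) / M) := by
  rw [constDistr, div_eq_inv_mul]
  rfl

theorem constDistr_apply (a : ℝ) (φ : TestFun M) :
    constDistr M a φ = a * TestFun.integralLin M φ := rfl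

theorem distrMeanFree_apply (w : Distr M) (φ : TestFun M) :
    distrMeanFree M w φ = w (TestFun.meanFree M φ) := by
  rw [distrMeanFree_eq_sub_constDistr, TestFun.meanFree_apply, map_sub, map_smul, smul_eq_mul,
    sub_apply, constDistr_apply]
  ring

theorem distrDeriv_apply (w : Distr M) (φ : TestFun M) :
    distrDeriv M w φ = -w (TestFun.derivLin M φ) := rfl

theorem distrPrimitive_apply (w : Distr M) (φ : TestFun M) :
    distrPrimitive M w φ = -w (TestFun.primitiveLin M φ) := rfl

variable (M) in
theorem distrDeriv_mul_distrPrimitive : distrDeriv M * distrPrimitive M = distrMeanFree M := by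
  ext w φ
  rw [Module.End.mul_apply, distrDeriv_apply, distrPrimitive_apply, neg_neg,
    TestFun.primitiveLin_derivLin, distrMeanFree_apply]

variable (M) in
theorem distrPrimitive_mul_distrDeriv : distrPrimitive M * distrDeriv M = distrMeanFree M := by
  ext w φ
  rw [Module.End.mul_apply, distrPrimitive_apply, distrDeriv_apply, neg_neg,
    TestFun.derivLin_primitiveLin, distrMeanFree_apply]

variable (M) in
theorem commute_distrDeriv_distrPrimitive : Commute (distrDeriv M) (distrPrimitive M) :=
  (distrDeriv_mul_distrPrimitive M).trans (distrPrimitive_mul_distrDeriv M).symm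

variable (M) in
theorem isIdempotentElem_distrMeanFree : IsIdempotentElem (distrMeanFree M) := by
  ext w φ
  rw [Module.End.mul_apply, distrMeanFree_apply, distrMeanFree_apply, distrMeanFree_apply,
    TestFun.meanFree_eq_self (TestFun.integralLin_meanFree φ)]

variable (M) in
theorem opL_mul_opLDagger (α : ℕ) : opL M α * opLDagger M α = distrMeanFree M := by
  rw [opL, opLDagger, ← (commute_distrDeriv_distrPrimitive M).mul_pow,
    distrDeriv_mul_distrPrimitive, (isIdempotentElem_distrMeanFree M).pow_succ_eq]

variable (M) in
theorem opLDagger_mul_opL (α : ℕ) : opLDagger M α * opL M α = distrMeanFree M := by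
  rw [opL, opLDagger, ← (commute_distrDeriv_distrPrimitive M).symm.mul_pow,
    distrPrimitive_mul_distrDeriv, (isIdempotentElem_distrMeanFree M).pow_succ_eq]

theorem opL_apply_one (α : ℕ) (w : Distr M) : opL M α w (TestFun.one M) = 0 := by
  rw [opL, pow_succ', Module.End.mul_apply, distrDeriv_apply, TestFun.derivLin_one, map_zero,
    neg_zero]

theorem opLDagger_apply_one (α : ℕ) (w : Distr M) : opLDagger M α w (TestFun.one M) = 0 := by
  rw [opLDagger, pow_succ', Module.End.mul_apply, distrPrimitive_apply, TestFun.primitiveLin_one,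
    map_zero, neg_zero]

theorem distrDeriv_constDistr (a : ℝ) : distrDeriv M (constDistr M a) = 0 := by
  ext φ
  rw [distrDeriv_apply, constDistr_apply, TestFun.integralLin_derivLin, mul_zero, neg_zero,
    zero_apply]

theorem opL_constDistr (α : ℕ) (a : ℝ) : opL M α (constDistr M a) = 0 := by
  rw [opL, pow_succ, Module.End.mul_apply, distrDeriv_constDistr, map_zero]

theorem opL_opLDagger_add_constDistr (α : ℕ) {w : Distr M} (hw : w (TestFun.one M) = 0) (a : ℝ) :
    opL M α (opLDagger M α w + constDistr M a) = w := by
  rw [map_add, opL_constDistr, add_zero, ← Module.End.mul_apply, opL_mul_opLDagger,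
    distrMeanFree_eq_sub_constDistr, hw, zero_div, constDistr, zero_smul, sub_zero]

theorem opLDagger_opL_add_constDistr (α : ℕ) (f : Distr M) :
    opLDagger M α (opL M α f) + constDistr M (f (TestFun.one M) / M) = f := by
  rw [← Module.End.mul_apply, opLDagger_mul_opL, distrMeanFree_eq_sub_constDistr, sub_add_cancel]

theorem opLDagger_add_constDistr_apply_one (α : ℕ) (w : Distr M) (a : ℝ) :
    (opLDagger M α w + constDistr M (a / M)) (TestFun.one M) = a := by
  rw [add_apply, opLDagger_apply_one, constDistr_apply,
    TestFun.integralLin_one, zero_add, div_mul_cancel₀ a hM.out.ne']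

end Pseudoinverse

section Isomorphisms

variable (M : ℝ) [hM : Fact (0 < M)] (α : ℕ)

theorem searchSpace_eq_prod : searchSpace M α = (nativeSpace M α).prod (nativeSpace M α) :=
  Submodule.ext fun _ => ritvNorm_lt_top_iff

/-- The identity of `X_L = M_L × M_L`, as a linear equivalence. -/
def searchSpaceLinearEquivProd : SearchSpace M α ≃ₗ[ℝ] NativeSpace M α × NativeSpace M α where
  toFun r := (⟨r.1.1, (ritvNorm_lt_top_iff.1 r.2).1⟩, ⟨r.1.2, (ritvNorm_lt_top_iff.1 r.2).2⟩)
  map_add' _ _ := rfl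
  map_smul' _ _ := rfl
  invFun p := ⟨(p.1.1, p.2.1), ritvNorm_lt_top_iff.2 ⟨p.1.2, p.2.2⟩⟩
  left_inv _ := rfl
  right_inv _ := rfl

variable {M α} in
theorem norm_searchSpaceLinearEquivProd_le (r : SearchSpace M α) :
    ‖searchSpaceLinearEquivProd M α r‖ ≤ ‖r‖ :=
  norm_prod_le_iff.2
    ⟨add_le_add (toReal_tvNorm_fst_le_ritvNorm (w := (opL M α r.1.1, opL M α r.1.2)) r.2)
        (norm_fst_le (r.1.1 (TestFun.one M), r.1.2 (TestFun.one M))),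
      add_le_add (toReal_tvNorm_snd_le_ritvNorm (w := (opL M α r.1.1, opL M α r.1.2)) r.2)
        (norm_snd_le (r.1.1 (TestFun.one M), r.1.2 (TestFun.one M)))⟩

variable {M α} in
theorem norm_le_add_norm_searchSpaceLinearEquivProd (r : SearchSpace M α) :
    ‖r‖ ≤ ‖(searchSpaceLinearEquivProd M α r).1‖ + ‖(searchSpaceLinearEquivProd M α r).2‖ :=
  (add_le_add (toReal_ritvNorm_le_tvNorm_add_tvNorm r.2)
    (max_le_add_of_nonneg (norm_nonneg _) (norm_nonneg _))).trans_eq (add_add_add_comm _ _ _ _)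

/-- The identity of `X_L = M_L × M_L`, as a linear homeomorphism. -/
def searchSpaceEquivProd : SearchSpace M α ≃L[ℝ] NativeSpace M α × NativeSpace M α :=
  (searchSpaceLinearEquivProd M α).toContinuousLinearEquivOfBounds 1 2
    (fun r => (norm_searchSpaceLinearEquivProd_le r).trans_eq (one_mul _).symm)
    (fun p => (norm_le_add_norm_searchSpaceLinearEquivProd _).trans <|
      (add_le_add (norm_fst_le p) (norm_snd_le p)).trans_eq (two_mul _).symm)

/-- The scalar version `f ↦ (L f, ⟨f, 1⟩)` of `T_L`, with inverse `(w, a) ↦ L† w + a / M`, as a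
linear equivalence. -/
def nativeSpaceLinearEquiv : NativeSpace M α ≃ₗ[ℝ] MeanZeroMeasure M × ℝ where
  toFun f := (⟨opL M α f.1, isRadon_of_tvNorm_lt_top f.2, opL_apply_one α f.1⟩,
    f.1 (TestFun.one M))
  map_add' f g := Prod.ext (Subtype.ext (map_add (opL M α) f.1 g.1)) rfl
  map_smul' c f := Prod.ext (Subtype.ext (map_smul (opL M α) c f.1)) rfl
  invFun p := ⟨opLDagger M α p.1.1 + constDistr M (p.2 / M), by
    change tvNorm M (opL M α _) < ⊤
    rw [opL_opLDagger_add_constDistr α p.1.2.2]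
    exact radonMeasures₀_le_finiteTV M p.1.2⟩
  left_inv f := Subtype.ext (opLDagger_opL_add_constDistr α f.1)
  right_inv p := Prod.ext (Subtype.ext (opL_opLDagger_add_constDistr α p.1.2.2 _))
    (opLDagger_add_constDistr_apply_one α p.1.1 p.2)

variable {M α} in
theorem norm_eq_add_norm_nativeSpaceLinearEquiv (f : NativeSpace M α) :
    ‖f‖ = ‖(nativeSpaceLinearEquiv M α f).1‖ + ‖(nativeSpaceLinearEquiv M α f).2‖ := rfl

/-- The scalar version `f ↦ (L f, ⟨f, 1⟩)` of `T_L`, as a linear homeomorphism of `M_L(T_M)` onto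
`M₀(T_M) × ℝ`. -/
def nativeSpaceEquiv : NativeSpace M α ≃L[ℝ] MeanZeroMeasure M × ℝ :=
  (nativeSpaceLinearEquiv M α).toContinuousLinearEquivOfBounds 1 2
    (fun f => by
      rw [one_mul, norm_eq_add_norm_nativeSpaceLinearEquiv]
      exact max_le_add_of_nonneg (norm_nonneg _) (norm_nonneg _))
    (fun p => by
      rw [norm_eq_add_norm_nativeSpaceLinearEquiv, LinearEquiv.apply_symm_apply, two_mul]
      exact add_le_add (norm_fst_le p) (norm_snd_le p))

/-- The isomorphism `T_L`, as the product of two copies of its scalar version. -/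
def searchSpaceEquiv :
    SearchSpace M α ≃L[ℝ] (MeanZeroMeasure M × MeanZeroMeasure M) × (ℝ × ℝ) :=
  ((searchSpaceEquivProd M α).trans
    ((nativeSpaceEquiv M α).prodCongr (nativeSpaceEquiv M α))).trans
    (ContinuousLinearEquiv.prodProdProdComm ℝ _ _ _ _)

end Isomorphisms

end PeriodicCurve

end

theorem mainTheorem5_general (M : ℝ) [Fact (0 < M)] (α : ℕ) :
    searchSpace M α =
        (nativeSpace M α).prod (nativeSpace M α) ∧
    (∃ e : SearchSpace M α ≃L[ℝ]
          NativeSpace M α × NativeSpace M α,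
      ∀ r : SearchSpace M α,
        (NativeSpace.toDistr M α (e r).1,
            NativeSpace.toDistr M α (e r).2) =
          SearchSpace.toDistr M α r) ∧
    ∃ T : SearchSpace M α ≃L[ℝ]
          (MeanZeroMeasure M × MeanZeroMeasure M) × (ℝ × ℝ),
      (∀ r : SearchSpace M α,
        MeanZeroMeasure.toDistr M (T r).1.1 =
            opL M α (SearchSpace.toDistr M α r).1 ∧
        MeanZeroMeasure.toDistr M (T r).1.2 =
            opL M α (SearchSpace.toDistr M α r).2 ∧
        (T r).2.1 =
            (SearchSpace.toDistr M α r).1 (TestFun.one M) ∧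
        (T r).2.2 =
            (SearchSpace.toDistr M α r).2 (TestFun.one M)) ∧
      ∀ (w₁ w₂ : MeanZeroMeasure M) (a₁ a₂ : ℝ),
        SearchSpace.toDistr M α (T.symm ((w₁, w₂), (a₁, a₂))) =
          (opLDagger M α (MeanZeroMeasure.toDistr M w₁) +
              constDistr M (a₁ / M),
            opLDagger M α (MeanZeroMeasure.toDistr M w₂) +
              constDistr M (a₂ / M)) :=
  ⟨searchSpace_eq_prod M α, ⟨searchSpaceEquivProd M α, fun _ => rfl⟩, searchSpaceEquiv M α,
    fun _ => ⟨rfl, rfl, rfl, rfl⟩, fun _ _ _ _ => rfl⟩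

theorem mainTheorem5 (M : ℝ) [Fact (0 < M)] (α : ℕ) (hα : 1 ≤ α) :
    -- `X_L = M_L × M_L`, as spaces of distributions and topologically
    searchSpace M α =
        (nativeSpace M α).prod (nativeSpace M α) ∧
    (∃ e : SearchSpace M α ≃L[ℝ]
          NativeSpace M α × NativeSpace M α,
      ∀ r : SearchSpace M α,
        (NativeSpace.toDistr M α (e r).1,
            NativeSpace.toDistr M α (e r).2) =
          SearchSpace.toDistr M α r) ∧
    -- the isomorphism `T_L` and its inverse
    ∃ T : SearchSpace M α ≃L[ℝ]
          (MeanZeroMeasure M × MeanZeroMeasure M) × (ℝ × ℝ),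
      (∀ r : SearchSpace M α,
        MeanZeroMeasure.toDistr M (T r).1.1 =
            opL M α (SearchSpace.toDistr M α r).1 ∧
        MeanZeroMeasure.toDistr M (T r).1.2 =
            opL M α (SearchSpace.toDistr M α r).2 ∧
        (T r).2.1 =
            (SearchSpace.toDistr M α r).1 (TestFun.one M) ∧
        (T r).2.2 =
            (SearchSpace.toDistr M α r).2 (TestFun.one M)) ∧
      ∀ (w₁ w₂ : MeanZeroMeasure M) (a₁ a₂ : ℝ),
        SearchSpace.toDistr M α (T.symm ((w₁, w₂), (a₁, a₂))) =
          (opLDagger M α (MeanZeroMeasure.toDistr M w₁) +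
              constDistr M (a₁ / M),
            opLDagger M α (MeanZeroMeasure.toDistr M w₂) +
              constDistr M (a₂ / M)) :=
  mainTheorem5_general M α
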